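/- Let $k$ be an algebraically closed field of characteristic $0$. For a commutative $k$-algebra $B$ and $B$-modules $N, N'$, let $\mathrm{HH}^1(B,\mathrm{Hom}_k(N,N'))$ be the quotient of the space of derivations $\psi : B \to \mathrm{Hom}_k(N,N')$ (that is, $k$-linear maps with $\psi(ab)(n)=a\,\psi(b)(n)+\psi(a)(bn)$) by the trivial derivations $a \mapsto a\chi-\chi a$, $\chi\in\mathrm{Hom}_k(N,N')$. It is identified with $\mathrm{Ext}^1_B(N,N')$ by sending the class of $\psi$ to the class of the extension $0\to N'\to N'\oplus N\to N\to 0$, where $a\in B$ acts on $N' \oplus N$ by $a(n',n)=(an'+\psi(a)(n),an)$. For a $B$-module $N$: * The Kodaira–Spencer map $g:\mathrm{Der}_k(B)\to \mathrm{Ext}^1_B(N,N)$ sends $D$ to the class of the derivation $\psi_D(a)(n)=D(a)n$, and $\mathsf V(N)=\ker(g)\subseteq \mathrm{Der}_k(B)$. It is a $B$-submodule, and it consists of those $D$ for which there is a $k$-linear map $\nabla_D:N\to N$ with $\nabla_D(an)=a\nabla_D(n)+D(a)n$ for all $a\in B$, $n\in N$. * Choose a $k$-linear map $\nabla:\mathsf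 V(N)\to \mathrm{End}_k(N)$ such that $\nabla_D(an)=a\nabla_D(n)+D(a)n$ for all $D\in\mathsf V(N)$, $a\in B$, $n\in N$. Then $\mathsf{lc}(N)\in\mathrm{Ext}^1_B(\mathsf V(N),\mathrm{End}_B(N))$ is the class of the derivation $\phi(a)(D)=a\nabla_D-\nabla_{aD}$. It does not depend on the choice of $\nabla$. **Lemma.** Let $A$ be a commutative $k$-algebra of finite type, let $\mathfrak m\subset A$ be a maximal ideal, and let $M$ be a finitely generated $A$-module such that $M_{\mathfrak p}$ is a free $A_{\mathfrak p}$-module for every prime ideal $\mathfrak p\neq \mathfrak m$ of $A$. Consider $M_{\mathfrak m}$ as a module over the local ring $A_{\mathfrak m}$, and the $\mathfrak m$-adic completion $\widehat M$ as a module over the $\mathfrak m$-adic completion $\widehat A$. Then 1. $\mathsf V(M)=\mathrm{Der}_k(A)\iff \mathsf V(M_{\mathfrak m})=\mathrm{Der}_k(A_{\mathfrak m})\iff \mathsf V(\widehat M)=\mathrm{Der}_k(\widehat A)$; 2. $\mathsf{lc}(M)=0\iff \mathsf{lc}(M_{\mathfrak m})=0\iff \mathsf{lc}(\widehat M)=0$.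 -/

import Mathlib

universe v u

set_option maxSynthPendingDepth 3

namespace KodairaSpencer

open CategoryTheory

noncomputable section

set_option linter.unusedSectionVars false

/-! ### First Hochschild cohomology with values in `Hom_k(M, N)` -/

section Hochschild

variable (k : Type v) (A M N : Type u) [Field k] [CommRing A] [Algebra k A]
  [AddCommGroup M] [Module A M] [Module k M] [IsScalarTower k A M]
  [AddCommGroup N] [Module A N] [Module k N] [IsScalarTower k A N]

/-- `Der_k(A, Hom_k(M, N))`, the Hochschild 1-cocycles of `A` with values in the bimodule
`Hom_k(M, N)`, where `(a φ)(m) = a φ(m)` and `(φ a)(m) = φ(a m)`. -/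
def Z1 : Submodule k (A →ₗ[k] M →ₗ[k] N) where
  carrier := {ψ | ∀ (a b : A) (m : M), ψ (a * b) m = a • ψ b m + ψ a (b • m)}
  zero_mem' := by intro a b m; simp
  add_mem' := by
    intro ψ χ hψ hχ a b m
    simp only [LinearMap.add_apply, hψ a b m, hχ a b m, smul_add]
    abel
  smul_mem' := by
    intro c ψ hψ a b m
    simp only [LinearMap.smul_apply, hψ a b m, smul_add, smul_comm c a]

/-- The differential `d⁰ : Hom_k(M, N) → Der_k(A, Hom_k(M, N))`, `d⁰(χ)(a) = a χ - χ a`.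
Its range consists of the trivial derivations. -/
def d0 : (M →ₗ[k] N) →ₗ[k] Z1 k A M N where
  toFun χ :=
    ⟨LinearMap.mk₂ k (fun (a : A) (m : M) => a • χ m - χ (a • m))
      (by intro a b m; simp only [add_smul, map_add]; abel)
      (by intro c a m; simp only [smul_assoc, map_smul, smul_sub])
      (by intro a m n; simp only [smul_add, map_add]; abel)
      (by intro c a m; simp only [smul_comm a c, map_smul, smul_sub]),
     by
      intro a b m
      simp only [LinearMap.mk₂_apply, mul_smul, smul_sub]
      abel⟩
  map_add' χ χ' := by
    ext a m
    simp only [LinearMap.mk₂_apply, LinearMap.add_apply, Submodule.coe_add, smul_add]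
    abel
  map_smul' c χ := by
    ext a m
    simp [smul_sub, smul_comm a c]

@[simp]
theorem d0_apply (χ : M →ₗ[k] N) (a : A) (m : M) :
    (d0 k A M N χ).1 a m = a • χ m - χ (a • m) := rfl

/-- The first Hochschild cohomology `HH¹(A, Hom_k(M, N))`. -/
abbrev HH1 : Type _ := Z1 k A M N ⧸ LinearMap.range (d0 k A M N)

end Hochschild

/-! ### The identification of `HH¹(A, Hom_k(M, N))` with `Ext¹_A(M, N)` -/

section Extension

variable {k : Type v} {A M N : Type u} [Field k] [CommRing A] [Algebra k A]
  [AddCommGroup M] [Module A M] [Module k M] [IsScalarTower k A M]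
  [AddCommGroup N] [Module A N] [Module k N] [IsScalarTower k A N]

/-- The extension of `M` by `N` given by a derivation `ψ : A → Hom_k(M, N)`: the abelian group
`N × M`, on which `a : A` acts as `a (n, m) = (a n + ψ(a)(m), a m)`. -/
def Extension (_ψ : Z1 k A M N) : Type u := N × M

instance (ψ : Z1 k A M N) : AddCommGroup (Extension ψ) :=
  inferInstanceAs (AddCommGroup (N × M))

instance (ψ : Z1 k A M N) : SMul A (Extension ψ) :=
  ⟨fun a x => (a • x.1 + ψ.1 a x.2, a • x.2)⟩

theorem Extension.smul_def (ψ : Z1 k A M N) (a : A) (x : Extension ψ) :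
    a • x = (a • x.1 + ψ.1 a x.2, a • x.2) := rfl

theorem Z1_map_one (ψ : Z1 k A M N) (m : M) : ψ.1 1 m = 0 := by
  have h := ψ.2 1 1 m
  simpa using h

instance (ψ : Z1 k A M N) : Module A (Extension ψ) where
  one_smul x := by
    refine Prod.ext ?_ ?_ <;> simp [Extension.smul_def, Z1_map_one]
  mul_smul a b x := by
    refine Prod.ext ?_ ?_
    · change (a * b) • x.1 + ψ.1 (a * b) x.2 = a • (b • x.1 + ψ.1 b x.2) + ψ.1 a (b • x.2)
      rw [ψ.2 a b, mul_smul, smul_add, add_assoc]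
    · change (a * b) • x.2 = a • b • x.2
      rw [mul_smul]
  smul_zero a := by
    refine Prod.ext ?_ ?_
    · change a • (0 : N) + ψ.1 a (0 : M) = 0
      simp
    · change a • (0 : M) = 0
      simp
  smul_add a x y := by
    refine Prod.ext ?_ ?_
    · change a • (x.1 + y.1) + ψ.1 a (x.2 + y.2) = (a • x.1 + ψ.1 a x.2) + (a • y.1 + ψ.1 a y.2)
      simp only [smul_add, map_add]
      abel
    · change a • (x.2 + y.2) = a • x.2 + a • y.2
      simp
  add_smul a b x := by
    refine Prod.ext ?_ ?_
    · change (a + b) • x.1 + ψ.1 (a + b) x.2 = (a • x.1 + ψ.1 a x.2) + (b • x.1 + ψ.1 b x.2)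
      simp only [add_smul, map_add, LinearMap.add_apply]
      abel
    · change (a + b) • x.2 = a • x.2 + b • x.2
      simp only [add_smul]
  zero_smul x := by
    refine Prod.ext ?_ ?_
    · change (0 : A) • x.1 + ψ.1 0 x.2 = 0
      simp
    · change (0 : A) • x.2 = 0
      simp

/-- The inclusion `N → N ×_ψ M`. -/
def Extension.inl (ψ : Z1 k A M N) : N →ₗ[A] Extension ψ where
  toFun n := (n, (0 : M))
  map_add' x y := by
    refine Prod.ext ?_ ?_
    · rfl
    · change (0 : M) = 0 + 0
      simp
  map_smul' a x := by
    refine Prod.ext ?_ ?_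
    · change a • x = a • x + ψ.1 a (0 : M)
      simp
    · change (0 : M) = a • (0 : M)
      simp

/-- The projection `N ×_ψ M → M`. -/
def Extension.snd (ψ : Z1 k A M N) : Extension ψ →ₗ[A] M where
  toFun x := x.2
  map_add' _ _ := rfl
  map_smul' _ _ := rfl

/-- The sequence `0 → N → N ×_ψ M → M → 0` of `A`-modules. -/
def Extension.shortComplex (ψ : Z1 k A M N) : ShortComplex (ModuleCat.{u} A) :=
  ShortComplex.moduleCatMk (Extension.inl ψ) (Extension.snd ψ) (by ext x; rfl)

theorem Extension.shortExact (ψ : Z1 k A M N) : (Extension.shortComplex ψ).ShortExact where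
  exact := by
    rw [ShortComplex.ShortExact.moduleCat_exact_iff_function_exact]
    intro x
    constructor
    · intro hx
      exact ⟨x.1, Prod.ext rfl (Eq.symm hx)⟩
    · rintro ⟨n, rfl⟩
      rfl
  mono_f := by
    refine (ModuleCat.mono_iff_injective _).2 ?_
    intro x y h
    exact congrArg Prod.fst h
  epi_g := by
    refine (ModuleCat.epi_iff_surjective _).2 ?_
    intro x
    exact ⟨((0 : N), x), rfl⟩

/-- The class in `Ext¹_A(M, N)` of the extension given by `ψ`. -/
def extClass (ψ : Z1 k A M N) :
    Abelian.Ext.{u} (ModuleCat.of A M) (ModuleCat.of A N) 1 :=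
  (Extension.shortExact ψ).extClass

/-- Derivations that differ by a trivial derivation have isomorphic extensions. -/
theorem extClass_eq_of_sub_mem {ψ ψ' : Z1 k A M N}
    (h : ψ - ψ' ∈ LinearMap.range (d0 k A M N)) : extClass ψ = extClass ψ' := by
  obtain ⟨χ, hχ⟩ := h
  have hχ' : ∀ (a : A) (m : M), a • χ m - χ (a • m) = ψ.1 a m - ψ'.1 a m := by
    intro a m
    have := congrArg (fun f : Z1 k A M N => f.1 a m) hχ
    simpa using this
  let F : Extension ψ →ₗ[A] Extension ψ' :=
    { toFun := fun x => (x.1 + χ x.2, x.2)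
      map_add' := by
        intro x y
        refine Prod.ext ?_ rfl
        change x.1 + y.1 + χ (x.2 + y.2) = (x.1 + χ x.2) + (y.1 + χ y.2)
        simp only [map_add]
        abel
      map_smul' := by
        intro a x
        refine Prod.ext ?_ rfl
        change a • x.1 + ψ.1 a x.2 + χ (a • x.2) = a • (x.1 + χ x.2) + ψ'.1 a x.2
        have := hχ' a x.2
        rw [sub_eq_sub_iff_add_eq_add] at this
        rw [smul_add, add_assoc, add_assoc, ← this] }
  let f : Extension.shortComplex ψ ⟶ Extension.shortComplex ψ' :=
    { τ₁ := 𝟙 _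
      τ₂ := ModuleCat.ofHom F
      τ₃ := 𝟙 _
      comm₁₂ := by
        ext n
        refine Prod.ext ?_ rfl
        have h0 : ∀ n' : N, n' = n' + χ (0 : M) := by simp
        exact h0 n
      comm₂₃ := by
        ext x
        rfl }
  have key := ShortComplex.ShortExact.extClass_naturality
    (Extension.shortExact ψ) (Extension.shortExact ψ') f
  change (Extension.shortExact ψ).extClass.comp (Abelian.Ext.mk₀ (𝟙 _)) (add_zero 1) =
    (Abelian.Ext.mk₀ (𝟙 _)).comp (Extension.shortExact ψ').extClass (zero_add 1) at key
  rw [Abelian.Ext.comp_mk₀_id, Abelian.Ext.mk₀_id_comp] at key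
  exact key

/-- The canonical map `HH¹(A, Hom_k(M, N)) → Ext¹_A(M, N)`. -/
def hh1ToExt : HH1 k A M N → Abelian.Ext.{u} (ModuleCat.of A M) (ModuleCat.of A N) 1 :=
  Quotient.lift extClass (by
    intro ψ ψ' h
    exact extClass_eq_of_sub_mem ((Submodule.quotientRel_def _).1 h))

theorem extClass_eq_zero_iff (ψ : Z1 k A M N) :
    extClass ψ = 0 ↔ ψ ∈ LinearMap.range (d0 k A M N) := by
  constructor
  · intro h
    have hS := Extension.shortExact ψ
    obtain ⟨x₂, hx₂⟩ := Abelian.Ext.covariant_sequence_exact₃ (ModuleCat.of A M) hS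
      (Abelian.Ext.mk₀ (𝟙 (ModuleCat.of A M))) (n₁ := 1) (by norm_num) ((Abelian.Ext.mk₀_id_comp _).trans h)
    obtain ⟨s, rfl⟩ := Abelian.Ext.addEquiv₀.symm.surjective x₂
    have hs : s ≫ (Extension.shortComplex ψ).g = 𝟙 (ModuleCat.of A M) := by
      apply Abelian.Ext.addEquiv₀.symm.injective
      have h3 : (Abelian.Ext.mk₀ s).comp (Abelian.Ext.mk₀ (Extension.shortComplex ψ).g)
        (add_zero 0) = Abelian.Ext.mk₀ (𝟙 (ModuleCat.of A M)) := hx₂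
      rw [Abelian.Ext.mk₀_comp_mk₀] at h3
      exact h3
    let t : M →ₗ[A] Extension ψ := s.hom
    have ht : ∀ m, (t m).2 = m := fun m =>
      congrArg (fun f : ModuleCat.of A M ⟶ ModuleCat.of A M => f.hom m) hs
    let χ : M →ₗ[k] N :=
      { toFun := fun m => -(t m).1
        map_add' := by
          intro x y
          have := congrArg Prod.fst (t.map_add x y)
          rw [this]
          change -((t x).1 + (t y).1) = _
          abel
        map_smul' := by
          intro c x
          have h1 : t (c • x) = algebraMap k A c • t x := by
            rw [← t.map_smul, algebraMap_smul]
          have h2 : ψ.1 (algebraMap k A c) (t x).2 = 0 := by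
            rw [Algebra.algebraMap_eq_smul_one, map_smul, LinearMap.smul_apply, Z1_map_one,
              smul_zero]
          rw [h1, Extension.smul_def]
          simp only [h2, add_zero, algebraMap_smul, RingHom.id_apply, smul_neg] }
    refine ⟨χ, ?_⟩
    ext a m
    have h1 := congrArg Prod.fst (t.map_smul a m)
    have h2 : (t (a • m)).1 = a • (t m).1 + ψ.1 a (t m).2 := h1
    rw [ht] at h2
    change a • (-(t m).1) - (-(t (a • m)).1) = ψ.1 a m
    rw [h2, smul_neg]
    abel
  · intro h
    have h0 : extClass ψ = extClass (0 : Z1 k A M N) :=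
      extClass_eq_of_sub_mem (by simpa using h)
    rw [h0]
    let s : ModuleCat.of A M ⟶ (Extension.shortComplex (0 : Z1 k A M N)).X₂ :=
      ModuleCat.ofHom
        { toFun := fun m => ((0 : N), m)
          map_add' := by
            intro x y
            refine Prod.ext ?_ rfl
            change (0 : N) = 0 + 0
            simp
          map_smul' := by
            intro a x
            refine Prod.ext ?_ rfl
            change (0 : N) = a • (0 : N) + 0
            simp }
    have hs : s ≫ (Extension.shortComplex (0 : Z1 k A M N)).g = 𝟙 _ := rfl
    have h1 := (Extension.shortExact (0 : Z1 k A M N)).comp_extClass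
    have h2 : (Abelian.Ext.mk₀ s).comp ((Abelian.Ext.mk₀
        (Extension.shortComplex (0 : Z1 k A M N)).g).comp
        (Extension.shortExact (0 : Z1 k A M N)).extClass (zero_add 1)) (zero_add 1) = 0 := by
      rw [h1, Abelian.Ext.comp_zero]
    rw [Abelian.Ext.mk₀_comp_mk₀_assoc, hs] at h2
    have h3 := Abelian.Ext.mk₀_id_comp (Extension.shortExact (0 : Z1 k A M N)).extClass
    exact h3.symm.trans h2

theorem hh1ToExt_mk (ψ : Z1 k A M N) :
    hh1ToExt (Submodule.Quotient.mk ψ : HH1 k A M N) = extClass ψ := rfl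

theorem hh1ToExt_eq_zero_iff (x : HH1 k A M N) : hh1ToExt x = 0 ↔ x = 0 := by
  obtain ⟨ψ, rfl⟩ := Submodule.Quotient.mk_surjective _ x
  rw [hh1ToExt_mk, extClass_eq_zero_iff, Submodule.Quotient.mk_eq_zero]

end Extension

/-! ### The Kodaira-Spencer map, its kernel, and the class `lc` -/

section Obstructions

variable (k : Type v) (A M : Type u) [Field k] [CommRing A] [Algebra k A]
  [AddCommGroup M] [Module A M] [Module k M] [IsScalarTower k A M]

variable {k A} in
/-- The derivation `ψ_D : A → End_k(M)`, `ψ_D(a)(m) = D(a) m`. -/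
def psi (D : Derivation k A A) : Z1 k A M M :=
  ⟨LinearMap.mk₂ k (fun (a : A) (m : M) => D a • m)
      (by intro a b m; simp only [map_add, add_smul])
      (by intro c a m; simp only [Derivation.map_smul, smul_assoc])
      (by intro a m n; simp only [smul_add])
      (by intro c a m; simp only [smul_comm (D a) c]),
    by
      intro a b m
      simp only [LinearMap.mk₂_apply, Derivation.leibniz, add_smul, smul_eq_mul, mul_smul,
        smul_comm (D a) b m]⟩

/-- The Kodaira-Spencer map `g : Der_k(A) → Ext¹_A(M, M)`. -/
def kodairaSpencer (D : Derivation k A A) :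
    Abelian.Ext.{u} (ModuleCat.of A M) (ModuleCat.of A M) 1 :=
  hh1ToExt (Submodule.Quotient.mk (psi M D) : HH1 k A M M)

variable {k A M} in
/-- `P ∈ End_k(M)` has the derivation property with respect to `D`. -/
def HasDerivationProperty (D : Derivation k A A) (P : M →ₗ[k] M) : Prop :=
  ∀ (a : A) (m : M), P (a • m) = a • P m + D a • m

theorem kodairaSpencer_eq_zero_iff (D : Derivation k A A) :
    kodairaSpencer k A M D = 0 ↔ ∃ P : M →ₗ[k] M, HasDerivationProperty D P := by
  rw [kodairaSpencer, hh1ToExt_mk, extClass_eq_zero_iff]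
  constructor
  · rintro ⟨χ, hχ⟩
    refine ⟨-χ, fun a m => ?_⟩
    have h : a • χ m - χ (a • m) = D a • m :=
      congrArg (fun f : Z1 k A M M => f.1 a m) hχ
    rw [← h]
    simp only [LinearMap.neg_apply, smul_neg]
    abel
  · rintro ⟨P, hP⟩
    refine ⟨-P, ?_⟩
    ext a m
    change a • (-P m) - (-P (a • m)) = D a • m
    rw [hP, smul_neg]
    abel

/-- The Kodaira-Spencer kernel `V(M) = ker(g) ⊆ Der_k(A)`, an `A`-submodule. -/
def V : Submodule A (Derivation k A A) where
  carrier := {D | kodairaSpencer k A M D = 0}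
  zero_mem' := (kodairaSpencer_eq_zero_iff k A M 0).2 ⟨0, fun a m => by simp⟩
  add_mem' := by
    intro D D' hD hD'
    obtain ⟨P, hP⟩ := (kodairaSpencer_eq_zero_iff k A M D).1 hD
    obtain ⟨P', hP'⟩ := (kodairaSpencer_eq_zero_iff k A M D').1 hD'
    refine (kodairaSpencer_eq_zero_iff k A M _).2 ⟨P + P', fun a m => ?_⟩
    simp only [LinearMap.add_apply, hP a m, hP' a m, Derivation.add_apply, smul_add, add_smul]
    abel
  smul_mem' := by
    intro b D hD
    obtain ⟨P, hP⟩ := (kodairaSpencer_eq_zero_iff k A M D).1 hD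
    refine (kodairaSpencer_eq_zero_iff k A M _).2 ⟨b • P, fun a m => ?_⟩
    simp only [LinearMap.smul_apply, hP a m, Derivation.smul_apply, smul_add, smul_assoc,
      smul_comm b a]

theorem mem_V_iff (D : Derivation k A A) :
    D ∈ V k A M ↔ kodairaSpencer k A M D = 0 := Iff.rfl

/-- A `k`-linear `V(M)`-connection on `M`: a `k`-linear map `∇ : V(M) → End_k(M)` such that each
`∇_D` has the derivation property with respect to `D`. -/
structure KLinearConnection where
  toLinearMap : V k A M →ₗ[k] (M →ₗ[k] M)
  derivation_property : ∀ D : V k A M, HasDerivationProperty D.1 (toLinearMap D)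

instance : Nonempty (KLinearConnection k A M) := by
  let c : Submodule k (V k A M × (M →ₗ[k] M)) :=
    { carrier := {x | HasDerivationProperty x.1.1 x.2}
      zero_mem' := by intro a m; simp
      add_mem' := by
        intro x y hx hy a m
        simp only [Prod.snd_add, Prod.fst_add, LinearMap.add_apply, hx a m, hy a m,
          Submodule.coe_add, Derivation.add_apply, smul_add, add_smul]
        abel
      smul_mem' := by
        intro b x hx a m
        have h : ((b • x).1 : Derivation k A A) = b • x.1.1 := rfl
        simp only [Prod.smul_snd, h, LinearMap.smul_apply, hx a m, Derivation.smul_apply,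
          smul_add, smul_assoc, smul_comm b a] }
  let p : c →ₗ[k] V k A M := (LinearMap.fst k _ _).comp c.subtype
  have hp : LinearMap.range p = ⊤ := by
    rw [LinearMap.range_eq_top]
    intro D
    obtain ⟨P, hP⟩ := (kodairaSpencer_eq_zero_iff k A M D.1).1 D.2
    exact ⟨⟨(D, P), hP⟩, rfl⟩
  obtain ⟨s, hs⟩ := p.exists_rightInverse_of_surjective hp
  refine ⟨⟨(LinearMap.snd k _ _).comp (c.subtype.comp s), fun D => ?_⟩⟩
  have h1 : (s D).1.1 = D := congrArg (fun f : V k A M →ₗ[k] V k A M => f D) hs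
  have h2 := (s D).2
  change HasDerivationProperty (s D).1.1.1 (s D).1.2 at h2
  rw [h1] at h2
  exact h2

variable {k A M}

/-- The derivation `φ : A → Hom_k(V(M), End_A(M))`, `φ(a)(D) = a ∇_D - ∇_{aD}`. -/
def KLinearConnection.phi (c : KLinearConnection k A M) :
    Z1 k A (V k A M) (Module.End A M) :=
  ⟨LinearMap.mk₂ k
      (fun (a : A) (D : V k A M) =>
        ({ toFun := fun m => a • c.toLinearMap D m - c.toLinearMap (a • D) m
           map_add' := by
            intro x y
            simp only [map_add, smul_add]
            abel
           map_smul' := by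
            intro b x
            have h : ((a • D : V k A M) : Derivation k A A) b = a • D.1 b := rfl
            simp only [c.derivation_property _ b x, h, smul_add, smul_sub, smul_assoc,
              smul_comm a b, RingHom.id_apply]
            abel } : Module.End A M))
      (by
        intro a b D
        ext m
        simp only [LinearMap.coe_mk, AddHom.coe_mk, LinearMap.add_apply, add_smul, map_add]
        abel)
      (by
        intro r a D
        ext m
        simp only [LinearMap.coe_mk, AddHom.coe_mk, LinearMap.smul_apply, smul_assoc, map_smul,
          smul_sub])
      (by
        intro a D D'
        ext m
        simp only [LinearMap.coe_mk, AddHom.coe_mk, LinearMap.add_apply, smul_add, map_add]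
        abel)
      (by
        intro r a D
        ext m
        simp only [LinearMap.coe_mk, AddHom.coe_mk, LinearMap.smul_apply, smul_comm a r, map_smul,
          smul_sub]),
    by
      intro a b D
      ext m
      simp only [LinearMap.mk₂_apply, LinearMap.coe_mk, AddHom.coe_mk, LinearMap.add_apply,
        LinearMap.smul_apply, mul_smul, smul_sub]
      abel⟩

@[simp]
theorem KLinearConnection.phi_apply (c : KLinearConnection k A M) (a : A) (D : V k A M) (m : M) :
    c.phi.1 a D m = a • c.toLinearMap D m - c.toLinearMap (a • D) m := rfl

/-- The class of `φ` in `HH¹(A, Hom_k(V(M), End_A(M)))` does not depend on `∇`. -/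
theorem KLinearConnection.phi_class_eq (c c' : KLinearConnection k A M) :
    (Submodule.Quotient.mk c.phi : HH1 k A (V k A M) (Module.End A M)) =
      Submodule.Quotient.mk c'.phi := by
  rw [Submodule.Quotient.eq]
  let χ : V k A M →ₗ[k] Module.End A M :=
    { toFun := fun D =>
        { toFun := fun m => c.toLinearMap D m - c'.toLinearMap D m
          map_add' := by
            intro x y
            simp only [map_add]
            abel
          map_smul' := by
            intro b x
            simp only [c.derivation_property _ b x, c'.derivation_property _ b x, smul_sub,
              RingHom.id_apply]
            abel }
      map_add' := by
        intro D D'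
        ext m
        simp only [LinearMap.coe_mk, AddHom.coe_mk, LinearMap.add_apply, map_add]
        abel
      map_smul' := by
        intro r D
        ext m
        simp only [LinearMap.coe_mk, AddHom.coe_mk, LinearMap.smul_apply, map_smul, smul_sub,
          RingHom.id_apply] }
  refine ⟨χ, ?_⟩
  ext a D m
  change a • (c.toLinearMap D m - c'.toLinearMap D m) -
      (c.toLinearMap (a • D) m - c'.toLinearMap (a • D) m) =
    (a • c.toLinearMap D m - c.toLinearMap (a • D) m) -
      (a • c'.toLinearMap D m - c'.toLinearMap (a • D) m)
  rw [smul_sub]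
  abel

variable (k A M)

/-- The class `lc(M) ∈ Ext¹_A(V(M), End_A(M))`, the class of `φ` for any choice of a `k`-linear
`V(M)`-connection on `M`. -/
def lc : Abelian.Ext.{u} (ModuleCat.of A (V k A M)) (ModuleCat.of A (Module.End A M)) 1 :=
  hh1ToExt (Submodule.Quotient.mk (Classical.arbitrary (KLinearConnection k A M)).phi :
    HH1 k A (V k A M) (Module.End A M))

theorem lc_eq (c : KLinearConnection k A M) :
    lc k A M = hh1ToExt (Submodule.Quotient.mk c.phi :
      HH1 k A (V k A M) (Module.End A M)) := by
  rw [lc, KLinearConnection.phi_class_eq]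

end Obstructions

/-- `M` is locally free on `Spec A ∖ {m}`. -/
def LocallyFreeAwayFrom {A : Type u} [CommRing A] (m : Ideal A)
    (M : Type u) [AddCommGroup M] [Module A M] : Prop :=
  ∀ p : PrimeSpectrum A, p.asIdeal ≠ m →
    Module.Free (Localization.AtPrime p.asIdeal) (LocalizedModule p.asIdeal.primeCompl M)

/-- The actions of `k` on the completions of `A` and of `M` are compatible. -/
instance adicCompletion_isScalarTower (k : Type v) (A M : Type u) [Field k] [CommRing A]
    [Algebra k A] [AddCommGroup M] [Module A M] [Module k M] [IsScalarTower k A M]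
    (m : Ideal A) : IsScalarTower k (AdicCompletion m A) (AdicCompletion m M) :=
  ⟨fun c x y => by
    have h1 : c • x = algebraMap k A c • x := by
      ext n
      simp [AdicCompletion.val_smul_apply]
    have h2 : c • (x • y) = algebraMap k A c • (x • y) := by
      ext n
      simp [AdicCompletion.val_smul_apply]
    rw [h1, h2, smul_assoc]⟩

end

end KodairaSpencer

namespace KodairaSpencer

open TensorProduct

noncomputable section

set_option linter.unusedSectionVars false

/-! ### Base change of modules of homomorphisms -/

section BaseChange

variable {R S M N P Q F : Type*} [CommRing R] [CommRing S] [Algebra R S]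
  [AddCommGroup M] [Module R M] [AddCommGroup N] [Module R N]
  [AddCommGroup P] [Module R P] [Module S P] [IsScalarTower R S P]
  [AddCommGroup Q] [Module R Q] [Module S Q] [IsScalarTower R S Q]
  [AddCommGroup F] [Module R F]

/-! Both conditions are the vanishing of finite `A`-modules, and these modules are supported at most
at `m`. Let At(M) be the Atiyah module of pairs (D, P) where P is a `k`-linear endomorphism of M
obeying the Leibniz rule for D, and let σ : At(M) → Der(A) be the projection. Its image is V(M), so
V(M) = Der(A) means that coker σ = 0. An `A`-linear connection is the same as a section of At(M) →
V(M), so lc(M) = 0 means that the cokernel of Hom(V(M), At(M)) → Hom(V(M), V(M)) vanishes.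

Let A → B be flat, with every derivation A → B extending uniquely to B, and let N = B ⊗ M. Then σ
for N is the base change of σ for M (`Atiyah.exists_isBaseChange`). The comparison goes through an
intermediate module of pairs (D : A → B, P : M → N). The Leibniz rule makes this module the kernel
of a `B`-linear map determined by a finite presentation of M, so flatness applies to it, and unique
extension identifies it with At(N). Hence both cokernels commute with base change along A → B.

Localizations satisfy the extension hypothesis because they are formally étale; the `m`-adic
completion satisfies it because a derivation loses at most one power of `m`. On a free module both
cokernels vanish, by differentiating coordinates. Localizing at maximal ideals I ≠ `m` therefore
shows that `m` is the only possible residue quotient A/I of either cokernel, and such a finite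
module vanishes exactly when its base change to B does, as long as `m`B ≠ B
(`subsingleton_iff_of_isBaseChange`). -/

/-- Homomorphisms out of a finitely presented module commute with flat base change. -/
theorem isBaseChange_compRight [Module.Flat R S] [Module.FinitePresentation R F]
    {ε : N →ₗ[R] P} (h : IsBaseChange S ε) :
    IsBaseChange S (LinearMap.compRight R ε (M := F)) := by
  obtain ⟨n, K, e, hK⟩ := Module.FinitePresentation.exists_fin R F
  obtain ⟨t, g, hg⟩ := (Submodule.fg_iff_exists_fin_linearMap _ _).1 hK
  let q : (Fin n → R) →ₗ[R] F := e.symm.toLinearMap ∘ₗ K.mkQ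
  have hq : Function.Surjective q := e.symm.surjective.comp K.mkQ_surjective
  have hgq : Function.Exact g q := by
    intro x
    rw [← LinearMap.coe_range, hg]
    simp [q]
  -- A presentation writes both Hom modules as kernels of maps between finite powers of `N` and of
  -- `P`; flatness preserves the kernel.
  refine IsBaseChange.of_left_exact S (f := LinearMap.lcomp R N q) (g := LinearMap.lcomp R N g)
    (f' := LinearMap.lcomp S P q)
    (g' := LinearMap.lcomp S P g) _ _ _ ?_ ?_
    (h.linearMapRight (Fin n → R)) (h.linearMapRight (Fin t → R)) (LinearMap.exact_lcomp_of_exact_of_surjective _ hgq hq)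
    (LinearMap.lcomp_injective_of_surjective q hq) (LinearMap.exact_lcomp_of_exact_of_surjective _ hgq hq)
    (LinearMap.lcomp_injective_of_surjective q hq)
  · rfl
  · rfl

/-- Homomorphisms out of a finitely presented module commute with flat base change. -/
theorem isBaseChange_linearMapLeftRightHom [Module.Flat R S] [Module.FinitePresentation R M]
    {α : M →ₗ[R] P} (j : IsBaseChange S α) {β : N →ₗ[R] Q} (h : IsBaseChange S β) :
    IsBaseChange S (IsBaseChange.linearMapLeftRightHom j β) := by
  -- The chain is S ⊗ Hom_R(M, N) ≅ Hom_R(M, Q) ≅ Hom_S(S ⊗ M, Q) ≅ Hom_S(P, Q).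
  apply IsBaseChange.of_equiv <|
      (isBaseChange_compRight (F := M) h).equiv ≪≫ₗ LinearMap.liftBaseChangeEquiv S ≪≫ₗ
        LinearEquiv.congrLeft Q S j.equiv
  intro f
  ext p
  simp [IsBaseChange.equiv_tmul, LinearEquiv.congrLeft, IsBaseChange.linearMapLeftRightHom_apply]

/-- The cokernel of a homomorphism commutes with base change. -/
theorem isBaseChange_mapQ_range {h₁ : M →ₗ[R] P} {h₂ : N →ₗ[R] Q} (i₁ : IsBaseChange S h₁)
    (i₂ : IsBaseChange S h₂) {g : M →ₗ[R] N} {g' : P →ₗ[S] Q} (comm : ∀ x, h₂ (g x) = g' (h₁ x)) :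
    ∃ h₃ : (N ⧸ LinearMap.range g) →ₗ[R] (Q ⧸ LinearMap.range g'),
      IsBaseChange S h₃ ∧ ∀ x, h₃ (Submodule.Quotient.mk x) = Submodule.Quotient.mk (h₂ x) := by
  let h₃ : (N ⧸ LinearMap.range g) →ₗ[R] (Q ⧸ LinearMap.range g') :=
    (LinearMap.range g).liftQ (((LinearMap.range g').mkQ.restrictScalars R) ∘ₗ h₂) (by
      rintro _ ⟨x, rfl⟩
      simp [comm])
  refine ⟨h₃, IsBaseChange.of_right_exact S h₁ h₂ h₃ (f := g) (g := (LinearMap.range g).mkQ)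
    (f' := g') (g' := (LinearMap.range g').mkQ) (LinearMap.ext comm) ?_ i₁ i₂
    (LinearMap.exact_map_mkQ_range g) (Submodule.mkQ_surjective _)
    (LinearMap.exact_map_mkQ_range g') (Submodule.mkQ_surjective _), ?_⟩
  · ext; simp [h₃]
  · intro x; simp [h₃]

/-- The range of a homomorphism commutes with flat base change. -/
theorem isBaseChange_range [Module.Flat R S] {h₁ : M →ₗ[R] P} {h₂ : N →ₗ[R] Q}
    (i₁ : IsBaseChange S h₁) (i₂ : IsBaseChange S h₂) {g : M →ₗ[R] N} {g' : P →ₗ[S] Q}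
    (comm : ∀ x, h₂ (g x) = g' (h₁ x)) :
    ∃ h₀ : LinearMap.range g →ₗ[R] LinearMap.range g',
      IsBaseChange S h₀ ∧ ∀ x, (h₀ x : Q) = h₂ x := by
  obtain ⟨h₃, i₃, hh₃⟩ := isBaseChange_mapQ_range i₁ i₂ comm
  let h₀ : LinearMap.range g →ₗ[R] LinearMap.range g' :=
    (h₂ ∘ₗ (LinearMap.range g).subtype).codRestrict ((LinearMap.range g').restrictScalars R) (by
      rintro ⟨_, x, rfl⟩
      exact ⟨h₁ x, (comm x).symm⟩)
  -- The range is the kernel of the projection to the cokernel, whose base change is already known.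
  refine ⟨h₀, IsBaseChange.of_left_exact S h₀ h₂ h₃ (f := (LinearMap.range g).subtype)
    (g := (LinearMap.range g).mkQ) (f' := (LinearMap.range g').subtype)
    (g' := (LinearMap.range g').mkQ) rfl (LinearMap.ext hh₃) i₂ i₃
    (LinearMap.exact_subtype_mkQ _) (Submodule.subtype_injective _)
    (LinearMap.exact_subtype_mkQ _) (Submodule.subtype_injective _), fun _ => rfl⟩

/-- A finite module with a nonzero quotient `R ⧸ I` cannot vanish after base change to `S`, unless
`I` becomes the unit ideal. -/
theorem map_eq_top_of_subsingleton {h : M →ₗ[R] P} (i : IsBaseChange S h) [Subsingleton P]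
    (I : Ideal R) (φ : M →ₗ[R] R ⧸ I) (hφ : Function.Surjective φ) :
    I.map (algebraMap R S) = ⊤ := by
  -- The composite M → R/I → S/IS takes the value 1, yet it factors through `P`, which is zero.
  let θ : (R ⧸ I) →ₗ[R] (S ⧸ I.map (algebraMap R S)) :=
    (Algebra.linearMap (R ⧸ I) (S ⧸ I.map (algebraMap R S))).restrictScalars R
  obtain ⟨x, hx⟩ := hφ 1
  have h0 : i.lift (θ ∘ₗ φ) (h x) = θ (φ x) := i.lift_eq _ x
  rw [Subsingleton.elim (h x) 0, map_zero, hx] at h0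
  have h1 : (1 : S ⧸ I.map (algebraMap R S)) = 0 := by
    rw [h0]
    exact (map_one (algebraMap (R ⧸ I) (S ⧸ I.map (algebraMap R S)))).symm
  rw [Ideal.eq_top_iff_one, ← Ideal.Quotient.eq_zero_iff_mem, map_one, h1]

/-- A nonzero finite module has a quotient of the form `R ⧸ I` with `I` maximal. -/
theorem exists_surjective_quot_maximal [Module.Finite R M] [Nontrivial M] :
    ∃ (I : Ideal R) (_ : I.IsMaximal) (φ : M →ₗ[R] R ⧸ I), Function.Surjective φ := by
  obtain ⟨K, hK⟩ := IsCoatomic.exists_coatom (Submodule R M)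
  have := isSimpleModule_iff_isCoatom.2 hK
  obtain ⟨I, hI, ⟨e⟩⟩ := isSimpleModule_iff_quot_maximal.1 this
  exact ⟨I, hI, e.toLinearMap ∘ₗ K.mkQ, e.surjective.comp K.mkQ_surjective⟩

end BaseChange

/-! ### The module of derivations along a homomorphism -/

section AtiyahAlong

variable (k : Type v) {A : Type*} (B : Type*) {M N : Type*} [Field k] [CommRing A] [Algebra k A]
  [CommRing B] [Algebra k B] [Algebra A B] [IsScalarTower k A B]
  [AddCommGroup M] [Module A M] [Module k M] [IsScalarTower k A M]
  [AddCommGroup N] [Module B N] [Module k N] [IsScalarTower k B N]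
  [Module A N] [IsScalarTower A B N] [IsScalarTower k A N]

/-- Pairs of a derivation `D : A → B` and a `k`-linear map `P : M → N` that satisfies the Leibniz
rule `P(am) = a P(m) + D(a) ι(m)`, where `N` is a `B`-module and `ι : M → N` is `A`-linear. -/
def AtiyahAlong (ι : M →ₗ[A] N) : Submodule B (Derivation k A B × (M →ₗ[k] N)) where
  carrier := {x | ∀ (a : A) (m : M), x.2 (a • m) = a • x.2 m + x.1 a • ι m}
  zero_mem' := by intro a m; simp
  add_mem' := by
    intro x y hx hy a m
    simp only [Prod.snd_add, Prod.fst_add, LinearMap.add_apply, hx a m, hy a m,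
      Derivation.add_apply, smul_add, add_smul]
    abel
  smul_mem' := by
    intro b x hx a m
    simp only [Prod.smul_snd, Prod.smul_fst, LinearMap.smul_apply, hx a m,
      Derivation.smul_apply, smul_add, smul_assoc, smul_comm b a]

variable {k B}

theorem AtiyahAlong.leibniz {ι : M →ₗ[A] N} (x : AtiyahAlong k B ι) (a : A) (m : M) :
    x.1.2 (a • m) = a • x.1.2 m + x.1.1 a • ι m := x.2 a m

@[ext]
theorem AtiyahAlong.ext {ι : M →ₗ[A] N} {x y : AtiyahAlong k B ι}
    (h₁ : ∀ a, x.1.1 a = y.1.1 a) (h₂ : ∀ m, x.1.2 m = y.1.2 m) : x = y :=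
  Subtype.ext (Prod.ext (Derivation.ext h₁) (LinearMap.ext h₂))

/-- The values on a derivation and on generators of `M`. -/
def AtiyahAlong.onGenerators (ι : M →ₗ[A] N) {n : ℕ} (q : (Fin n → A) →ₗ[A] M) :
    AtiyahAlong k B ι →ₗ[B] Derivation k A B × (Fin n → N) where
  toFun x := (x.1.1, fun j => x.1.2 (q (Pi.single j 1)))
  map_add' _ _ := rfl
  map_smul' _ _ := rfl

/-- The extension by the Leibniz rule of given values on generators. -/
def leibnizLift (ι : M →ₗ[A] N) {n : ℕ} (q : (Fin n → A) →ₗ[A] M) (D : Derivation k A B)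
    (p : Fin n → N) : (Fin n → A) →ₗ[k] N where
  toFun a := ∑ j, (a j • p j + D (a j) • ι (q (Pi.single j 1)))
  map_add' a b := by
    rw [← Finset.sum_add_distrib]
    refine Finset.sum_congr rfl fun j _ => ?_
    simp only [Pi.add_apply, add_smul, map_add]
    abel
  map_smul' c a := by
    rw [RingHom.id_apply, Finset.smul_sum]
    refine Finset.sum_congr rfl fun j _ => ?_
    simp only [Pi.smul_apply, Derivation.map_smul, smul_add, smul_assoc]

theorem leibnizLift_smul (ι : M →ₗ[A] N) {n : ℕ} (q : (Fin n → A) →ₗ[A] M) (D : Derivation k A B)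
    (p : Fin n → N) (c : A) (a : Fin n → A) :
    leibnizLift ι q D p (c • a) = c • leibnizLift ι q D p a + D c • ι (q a) := by
  have h : q a = ∑ j, a j • q (Pi.single j 1) := by
    conv_lhs => rw [pi_eq_sum_univ' a]
    rw [map_sum]
    refine Finset.sum_congr rfl fun j _ => ?_
    rw [map_smul]
  rw [h, map_sum, Finset.smul_sum]
  simp only [leibnizLift, LinearMap.coe_mk, AddHom.coe_mk]
  rw [Finset.smul_sum, ← Finset.sum_add_distrib]
  refine Finset.sum_congr rfl fun j _ => ?_
  simp only [Pi.smul_apply, smul_eq_mul, Derivation.leibniz, add_smul, mul_smul, smul_add,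
    smul_assoc, map_smul]
  rw [smul_comm (D c) (a j)]
  abel

theorem leibnizLift_single (ι : M →ₗ[A] N) {n : ℕ} (q : (Fin n → A) →ₗ[A] M)
    (D : Derivation k A B) (p : Fin n → N) (j : Fin n) :
    leibnizLift ι q D p (Pi.single j 1) = p j := by
  simp only [leibnizLift, LinearMap.coe_mk, AddHom.coe_mk]
  rw [Finset.sum_eq_single j]
  · simp
  · intro i _ hij
    simp [Pi.single_eq_of_ne hij]
  · simp

/-- By the Leibniz rule, P is determined by D and by its values on generators. This replaces the
non-linear datum P by a finite tuple in `N`. -/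
theorem AtiyahAlong.apply_eq_leibnizLift {ι : M →ₗ[A] N} (x : AtiyahAlong k B ι) {n : ℕ}
    (q : (Fin n → A) →ₗ[A] M) (a : Fin n → A) :
    x.1.2 (q a) = leibnizLift ι q x.1.1 (AtiyahAlong.onGenerators ι q x).2 a := by
  conv_lhs => rw [pi_eq_sum_univ' a]
  rw [map_sum, map_sum]
  refine Finset.sum_congr rfl fun j _ => ?_
  rw [map_smul, AtiyahAlong.leibniz]
  rfl

/-- The values of the extension by the Leibniz rule on relations. -/
def leibnizRelations (ι : M →ₗ[A] N) {n t : ℕ} (q : (Fin n → A) →ₗ[A] M)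
    (g : (Fin t → A) →ₗ[A] (Fin n → A)) :
    Derivation k A B × (Fin n → N) →ₗ[B] (Fin t → N) where
  toFun x i := leibnizLift ι q x.1 x.2 (g (Pi.single i 1))
  map_add' x y := by
    ext i
    simp only [leibnizLift, LinearMap.coe_mk, AddHom.coe_mk, Pi.add_apply]
    rw [← Finset.sum_add_distrib]
    refine Finset.sum_congr rfl fun j _ => ?_
    simp only [Prod.fst_add, Prod.snd_add, Pi.add_apply, Derivation.add_apply, add_smul, smul_add]
    abel
  map_smul' b x := by
    ext i
    simp only [leibnizLift, LinearMap.coe_mk, AddHom.coe_mk, Pi.smul_apply, RingHom.id_apply]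
    rw [Finset.smul_sum]
    refine Finset.sum_congr rfl fun j _ => ?_
    simp only [Prod.smul_fst, Prod.smul_snd, Pi.smul_apply, Derivation.smul_apply, smul_add,
      smul_assoc, smul_comm b]

theorem AtiyahAlong.onGenerators_injective (ι : M →ₗ[A] N) {n : ℕ} {q : (Fin n → A) →ₗ[A] M}
    (hq : Function.Surjective q) :
    Function.Injective (AtiyahAlong.onGenerators (k := k) (B := B) ι q) := by
  intro x y h
  have h1 : x.1.1 = y.1.1 := congrArg (fun z => z.1) h
  refine AtiyahAlong.ext (fun a => by rw [h1]) fun m => ?_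
  obtain ⟨a, rfl⟩ := hq m
  rw [AtiyahAlong.apply_eq_leibnizLift x, AtiyahAlong.apply_eq_leibnizLift y, h, h1]

/-- Prescribed values on generators descend from the free module to M exactly when their Leibniz
extension kills the relations. This presents the module of pairs as a kernel. -/
theorem AtiyahAlong.exact_onGenerators (ι : M →ₗ[A] N) {n t : ℕ} {q : (Fin n → A) →ₗ[A] M}
    (hq : Function.Surjective q) {g : (Fin t → A) →ₗ[A] (Fin n → A)} (hgq : Function.Exact g q) :
    Function.Exact (AtiyahAlong.onGenerators (k := k) (B := B) ι q) (leibnizRelations ι q g) := by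
  rintro ⟨D, p⟩
  constructor
  · intro h
    -- Vanishing on generating relations suffices: the extra term D(c) ι(q(·)) is zero because `q`
    -- kills relations.
    have hker : ∀ a, q a = 0 → leibnizLift ι q D p a = 0 := by
      intro a ha
      obtain ⟨b, rfl⟩ := (hgq a).1 ha
      rw [pi_eq_sum_univ' b, map_sum, map_sum]
      refine Finset.sum_eq_zero fun j _ => ?_
      rw [map_smul, leibnizLift_smul, hgq.apply_apply_eq_zero,
        show leibnizLift ι q D p (g (Pi.single j 1)) = 0 from congrFun h j]
      simp
    -- The section is only `k`-linear. Since the lift vanishes on ker `q`, the choice is harmless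
    -- and the Leibniz rule passes to M.
    obtain ⟨σ, hσ⟩ := (q.restrictScalars k).exists_rightInverse_of_surjective
      (LinearMap.range_eq_top.2 hq)
    have hσ' : ∀ m, q (σ m) = m := fun m => LinearMap.congr_fun hσ m
    have hP : ∀ a, leibnizLift ι q D p (σ (q a)) = leibnizLift ι q D p a := by
      intro a
      rw [← sub_eq_zero, ← map_sub]
      exact hker _ (by rw [map_sub, hσ', sub_self])
    refine ⟨⟨(D, leibnizLift ι q D p ∘ₗ σ), fun a m => ?_⟩, ?_⟩
    · change leibnizLift ι q D p (σ (a • m)) = a • leibnizLift ι q D p (σ m) + D a • ι m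
      conv_lhs => rw [← hσ' m, ← map_smul q]
      rw [hP, leibnizLift_smul, hσ']
    · refine Prod.ext rfl (funext fun j => ?_)
      exact (hP _).trans (leibnizLift_single ι q D p j)
  · rintro ⟨x, hx⟩
    ext i
    have := AtiyahAlong.apply_eq_leibnizLift x q (g (Pi.single i 1))
    rw [hgq.apply_apply_eq_zero, map_zero] at this
    rw [← hx]
    exact this.symm

end AtiyahAlong

/-! ### Base change of derivations and of the Atiyah module -/

section AtiyahBaseChange

variable (k : Type v) {A : Type*} (B : Type*) {M N : Type*} [Field k] [CommRing A] [Algebra k A]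
  [CommRing B] [Algebra k B] [Algebra A B] [IsScalarTower k A B]
  [AddCommGroup M] [Module A M] [Module k M] [IsScalarTower k A M]
  [AddCommGroup N] [Module B N] [Module k N] [IsScalarTower k B N]
  [Module A N] [IsScalarTower A B N] [IsScalarTower k A N]

/-- Derivations are homomorphisms out of Ω[A⁄k], which is finitely presented because A is of finite
type over a field. -/
theorem isBaseChange_compDer [Algebra.FiniteType k A] [Module.Flat A B] :
    IsBaseChange B ((Algebra.linearMap A B).compDer (R := k)) := by
  have := Algebra.FiniteType.isNoetherianRing k A
  have hfp : Module.FinitePresentation A (Ω[A⁄k]) := Module.finitePresentation_of_finite _ _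
  let e : (Ω[A⁄k] →ₗ[A] B) ≃ₗ[B] Derivation k A B :=
    { KaehlerDifferential.linearMapEquivDerivation k A with
      map_smul' := fun b f => by ext; rfl }
  refine (IsBaseChange.iff_of_equiv_comm (KaehlerDifferential.linearMapEquivDerivation k A) e ?_).1
    (isBaseChange_compRight (F := Ω[A⁄k]) (IsBaseChange.linearMap A B))
  ext
  rfl

/-- The Atiyah module of `M`: pairs of a derivation `D` and a `k`-linear endomorphism of `M` with
the derivation property with respect to `D`. -/
abbrev Atiyah (A M : Type*) [CommRing A] [Algebra k A] [AddCommGroup M] [Module A M] [Module k M]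
    [IsScalarTower k A M] : Submodule A (Derivation k A A × (M →ₗ[k] M)) :=
  AtiyahAlong k A (LinearMap.id : M →ₗ[A] M)

/-- Composition of the components with `A → B` and `ι : M → N`. -/
def Atiyah.along (ι : M →ₗ[A] N) : Atiyah k A M →ₗ[A] AtiyahAlong k B ι where
  toFun x := ⟨((Algebra.linearMap A B).compDer x.1.1, (ι.restrictScalars k) ∘ₗ x.1.2), by
    intro a m
    simp [AtiyahAlong.leibniz x a m]⟩
  map_add' x y := by ext <;> simp
  map_smul' a x := by ext <;> simp [Algebra.smul_def]

/-- Both sides are kernels of the maps Der × Mⁿ → Mᵗ and Der × Nⁿ → Nᵗ given by one presentation of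
M. These maps are compatible with base change, and flatness preserves kernels. -/
theorem Atiyah.isBaseChange_along [Algebra.FiniteType k A] [Module.Flat A B] [Module.Finite A M]
    {ι : M →ₗ[A] N} (hι : IsBaseChange B ι) : IsBaseChange B (Atiyah.along k B ι) := by
  have := Algebra.FiniteType.isNoetherianRing k A
  have hfp : Module.FinitePresentation A M := Module.finitePresentation_of_finite _ _
  obtain ⟨n, K, e, hK⟩ := Module.FinitePresentation.exists_fin A M
  obtain ⟨t, g, hg⟩ := (Submodule.fg_iff_exists_fin_linearMap _ _).1 hK
  let q : (Fin n → A) →ₗ[A] M := e.symm.toLinearMap ∘ₗ K.mkQ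
  have hq : Function.Surjective q := e.symm.surjective.comp K.mkQ_surjective
  have hgq : Function.Exact g q := by
    intro x
    rw [← LinearMap.coe_range, hg]
    simp [q]
  let h₂ : Derivation k A A × (Fin n → M) →ₗ[A] Derivation k A B × (Fin n → N) :=
    ((Algebra.linearMap A B).compDer (R := k)).prodMap
      (LinearMap.pi fun i : Fin n => ι ∘ₗ LinearMap.proj i)
  let h₃ : (Fin t → M) →ₗ[A] (Fin t → N) := LinearMap.pi fun i : Fin t => ι ∘ₗ LinearMap.proj i
  have i₂ : IsBaseChange B h₂ :=
    (isBaseChange_compDer k B).prodMap _ _ (IsBaseChange.pi (fun _ : Fin n => ι) fun _ => hι)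
  have i₃ : IsBaseChange B h₃ := IsBaseChange.pi (fun _ : Fin t => ι) fun _ => hι
  have comm : ∀ x, h₃ (leibnizRelations LinearMap.id q g x) = leibnizRelations ι q g (h₂ x) := by
    intro x
    ext i
    simp [h₂, h₃, leibnizRelations, leibnizLift]
  exact IsBaseChange.of_left_exact B (Atiyah.along k B ι) h₂ h₃
    (f := AtiyahAlong.onGenerators LinearMap.id q) (g := leibnizRelations LinearMap.id q g)
    (f' := AtiyahAlong.onGenerators ι q) (g' := leibnizRelations ι q g)
    rfl (LinearMap.ext comm) i₂ i₃
    (AtiyahAlong.exact_onGenerators LinearMap.id hq hgq)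
    (AtiyahAlong.onGenerators_injective LinearMap.id hq)
    (AtiyahAlong.exact_onGenerators ι hq hgq)
    (AtiyahAlong.onGenerators_injective ι hq)

/-- Restriction along `A → B` and `ι : M → N`. -/
def Atiyah.restrict (ι : M →ₗ[A] N) : Atiyah k B N →ₗ[B] AtiyahAlong k B ι where
  toFun x := ⟨(x.1.1.compAlgebraMap A, x.1.2 ∘ₗ (ι.restrictScalars k)), by
    intro a m
    have := AtiyahAlong.leibniz x (algebraMap A B a) (ι m)
    simpa using this⟩
  map_add' x y := rfl
  map_smul' a x := rfl

variable {k B}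

theorem Atiyah.restrict_injective
    (hder : Function.Bijective (Derivation.compAlgebraMapL k A B B)) {ι : M →ₗ[A] N}
    (hι : IsBaseChange B ι) : Function.Injective (Atiyah.restrict k B ι) := by
  intro x y h
  have h1 : x.1.1 = y.1.1 := hder.1 (congrArg (fun z => z.1.1) h)
  have h2 : ∀ m, x.1.2 (ι m) = y.1.2 (ι m) := fun m =>
    LinearMap.congr_fun (congrArg (fun z => z.1.2) h) m
  refine AtiyahAlong.ext (fun b => by rw [h1]) fun n => ?_
  induction n using hι.inductionOn with
  | zero => simp
  | tmul m => exact h2 m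
  | smul b n hn => rw [AtiyahAlong.leibniz, AtiyahAlong.leibniz, h1, hn]
  | add n n' hn hn' => rw [map_add, map_add, hn, hn']

/-- Once D is extended to B, the Leibniz rule forces the extension of P: b ⊗ m goes to b P(m) + D(b)
ι(m). -/
theorem Atiyah.restrict_surjective
    (hder : Function.Bijective (Derivation.compAlgebraMapL k A B B)) {ι : M →ₗ[A] N}
    (hι : IsBaseChange B ι) : Function.Surjective (Atiyah.restrict k B ι) := by
  intro x
  obtain ⟨D, hD⟩ := hder.2 x.1.1
  have hD' : ∀ a : A, D (algebraMap A B a) = x.1.1 a := fun a => Derivation.congr_fun hD a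
  -- This map is only additive, hence the additive form of the universal property; being balanced
  -- over A is the Leibniz rule for P.
  let F : B ⊗[A] M →+ N := TensorProduct.liftAddHom
    { toFun := fun b =>
        { toFun := fun m => b • x.1.2 m + D b • ι m
          map_zero' := by simp
          map_add' := fun m m' => by simp only [map_add, smul_add]; abel }
      map_zero' := by ext; simp
      map_add' := fun b b' => by
        ext m
        simp only [map_add, add_smul, AddMonoidHom.coe_mk, ZeroHom.coe_mk, AddMonoidHom.add_apply]
        abel } (by
      intro a b m
      simp only [AddMonoidHom.coe_mk, ZeroHom.coe_mk, AtiyahAlong.leibniz x a m, map_smul]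
      rw [Algebra.smul_def a b, Derivation.leibniz, hD', mul_smul, smul_add, add_smul, smul_assoc,
        smul_assoc, algebraMap_smul, algebraMap_smul, smul_comm b a, smul_comm b (x.1.1 a) (ι m),
        smul_comm (D b) a]
      abel)
  have hF : ∀ (b : B) (m : M), F (b ⊗ₜ m) = b • x.1.2 m + D b • ι m := fun _ _ => rfl
  have hFs : ∀ (b : B) (z : B ⊗[A] M), F (b • z) = b • F z + D b • hι.equiv z := by
    intro b z
    induction z with
    | zero => simp
    | tmul c m =>
      rw [TensorProduct.smul_tmul', hF, hF, hι.equiv_tmul, smul_eq_mul, Derivation.leibniz]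
      simp only [add_smul, smul_add, mul_smul, smul_eq_mul]
      rw [smul_comm c (D b)]
      abel
    | add z z' hz hz' => simp only [smul_add, map_add, hz, hz']; abel
  let P : N →ₗ[k] N :=
    { toFun := fun n => F (hι.equiv.symm n)
      map_add' := by simp
      map_smul' := by
        intro c n
        rw [← algebraMap_smul B c n, map_smul, hFs]
        simp }
  refine ⟨⟨(D, P), fun b n => ?_⟩, ?_⟩
  · change F (hι.equiv.symm (b • n)) = b • F (hι.equiv.symm n) + D b • n
    rw [map_smul, hFs, LinearEquiv.apply_symm_apply]
  · refine AtiyahAlong.ext hD' fun m => ?_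
    change F (hι.equiv.symm (ι m)) = x.1.2 m
    rw [hι.equiv_symm_apply, hF]
    simp

/-- The projection from the Atiyah module to the derivations. -/
def Atiyah.symbol (k A M : Type*) [Field k] [CommRing A] [Algebra k A] [AddCommGroup M]
    [Module A M] [Module k M] [IsScalarTower k A M] : Atiyah k A M →ₗ[A] Derivation k A A :=
  LinearMap.fst A _ _ ∘ₗ (Atiyah k A M).subtype

/-- The Atiyah module and its projection to the derivations commute with flat base change along
`A → B`, if derivations of `A` with values in `B` extend uniquely to `B`. -/
theorem Atiyah.exists_isBaseChange [Algebra.FiniteType k A] [Module.Flat A B] [Module.Finite A M]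
    (hder : Function.Bijective (Derivation.compAlgebraMapL k A B B)) {ι : M →ₗ[A] N}
    (hι : IsBaseChange B ι) :
    ∃ (τ : Atiyah k A M →ₗ[A] Atiyah k B N) (δ : Derivation k A A →ₗ[A] Derivation k B B),
      IsBaseChange B τ ∧ IsBaseChange B δ ∧
        ∀ x, δ (Atiyah.symbol k A M x) = Atiyah.symbol k B N (τ x) := by
  let e₁ : Derivation k B B ≃ₗ[B] Derivation k A B := LinearEquiv.ofBijective _ hder
  let e₂ : Atiyah k B N ≃ₗ[B] AtiyahAlong k B ι := LinearEquiv.ofBijective (Atiyah.restrict k B ι)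
    ⟨Atiyah.restrict_injective hder hι, Atiyah.restrict_surjective hder hι⟩
  refine ⟨e₂.symm.toLinearMap.restrictScalars A ∘ₗ Atiyah.along k B ι,
    e₁.symm.toLinearMap.restrictScalars A ∘ₗ (Algebra.linearMap A B).compDer,
    (Atiyah.isBaseChange_along k B hι).comp (.ofEquiv e₂.symm),
    (isBaseChange_compDer k B).comp (.ofEquiv e₁.symm), fun x => ?_⟩
  apply e₁.injective
  obtain ⟨y, hy⟩ := e₂.surjective (Atiyah.along k B ι x)
  simp only [LinearMap.comp_apply, LinearMap.restrictScalars_apply, LinearEquiv.coe_coe,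
    LinearEquiv.apply_symm_apply]
  rw [← hy, LinearEquiv.symm_apply_apply]
  exact congrArg (fun z => z.1.1) hy.symm

end AtiyahBaseChange

/-! ### The conditions `V(M) = Der_k(A)` and `lc(M) = 0` as vanishing of cokernels -/

section Criteria

variable (k : Type v) (A M : Type u) [Field k] [CommRing A] [Algebra k A]
  [AddCommGroup M] [Module A M] [Module k M] [IsScalarTower k A M]

theorem Atiyah.range_symbol : LinearMap.range (Atiyah.symbol k A M) = V k A M := by
  ext D
  rw [mem_V_iff, kodairaSpencer_eq_zero_iff]
  constructor
  · rintro ⟨x, rfl⟩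
    exact ⟨x.1.2, AtiyahAlong.leibniz x⟩
  · rintro ⟨P, hP⟩
    exact ⟨⟨(D, P), hP⟩, rfl⟩

/-- The cocycle `phi` measures the failure of ∇ to be `A`-linear. It is trivial exactly when ∇ can
be corrected by `A`-linear endomorphisms of M to become `A`-linear in D. -/
theorem lc_eq_zero_iff_exists_section :
    lc k A M = 0 ↔ ∃ s : V k A M →ₗ[A] Atiyah k A M, ∀ D, Atiyah.symbol k A M (s D) = D := by
  let c : KLinearConnection k A M := Classical.arbitrary _
  rw [lc, hh1ToExt_eq_zero_iff, Submodule.Quotient.mk_eq_zero]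
  constructor
  · rintro ⟨χ, hχ⟩
    have hχ' : ∀ (a : A) (D : V k A M) (m : M),
        a • χ D m - χ (a • D) m = a • c.toLinearMap D m - c.toLinearMap (a • D) m := fun a D m =>
      LinearMap.congr_fun (congrArg (fun f : Z1 k A (V k A M) (Module.End A M) => f.1 a D) hχ) m
    -- The corrected connection is ∇ - χ; the coboundary equation `hχ'` is its `A`-linearity.
    refine ⟨{ toFun := fun D => ⟨(D.1, c.toLinearMap D - (χ D).restrictScalars k), ?_⟩
              map_add' := ?_
              map_smul' := ?_ }, fun D => rfl⟩
    · intro a m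
      simp only [LinearMap.sub_apply, LinearMap.restrictScalars_apply, map_smul,
        c.derivation_property D a m, smul_sub, LinearMap.id_apply]
      abel
    · intro D D'
      refine AtiyahAlong.ext (fun _ => rfl) fun m => ?_
      simp only [map_add, Submodule.coe_add, Prod.snd_add, LinearMap.add_apply,
        LinearMap.sub_apply, LinearMap.restrictScalars_apply]
      abel
    · intro a D
      refine AtiyahAlong.ext (fun _ => rfl) fun m => ?_
      simp only [Submodule.coe_smul, Prod.smul_snd, LinearMap.smul_apply,
        LinearMap.sub_apply, LinearMap.restrictScalars_apply, RingHom.id_apply, smul_sub]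
      have := hχ' a D m
      rw [sub_eq_sub_iff_add_eq_add] at this ⊢
      rw [add_comm, ← this, add_comm]
  · rintro ⟨s, hs⟩
    have hs' : ∀ (D : V k A M) (a : A) (m : M), (s D).1.2 (a • m) = a • (s D).1.2 m + D.1 a • m :=
      fun D a m => by
        have h1 := AtiyahAlong.leibniz (s D) a m
        have h2 : (s D).1.1 = D := hs D
        rwa [h2] at h1
    -- The section is itself a connection with zero cocycle, and the class does not depend on the
    -- connection.
    let c' : KLinearConnection k A M :=
      { toLinearMap :=
          { toFun := fun D => (s D).1.2
            map_add' := fun D D' => by rw [map_add]; rfl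
            map_smul' := fun b D => by
              rw [← algebraMap_smul A b D, map_smul, RingHom.id_apply,
                ← algebraMap_smul A b (s D).1.2]
              rfl }
        derivation_property := hs' }
    have h := (Submodule.Quotient.eq _).1 (KLinearConnection.phi_class_eq c c')
    have h0 : c'.phi = 0 := by
      ext a D m
      change a • (s D).1.2 m - (s (a • D)).1.2 m = 0
      rw [map_smul, sub_eq_zero]
      rfl
    rwa [h0, sub_zero] at h

/-- The cokernel of `Atiyah(M) → Der_k(A)`. -/
abbrev SymbolCokernel : Type _ := Derivation k A A ⧸ LinearMap.range (Atiyah.symbol k A M)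

/-- Composition with the projection of the Atiyah module onto the Kodaira-Spencer kernel. -/
abbrev Atiyah.compSymbol :=
  LinearMap.compRight A (Atiyah.symbol k A M).rangeRestrict
    (M := LinearMap.range (Atiyah.symbol k A M))

/-- The obstruction to splitting the projection of the Atiyah module onto the Kodaira-Spencer
kernel. -/
abbrev SplittingCokernel : Type _ :=
  (LinearMap.range (Atiyah.symbol k A M) →ₗ[A] LinearMap.range (Atiyah.symbol k A M)) ⧸
    LinearMap.range (Atiyah.compSymbol k A M)

theorem V_eq_top_iff_subsingleton : V k A M = ⊤ ↔ Subsingleton (SymbolCokernel k A M) := by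
  rw [← Atiyah.range_symbol, Submodule.Quotient.subsingleton_iff]

/-- A section lifts every endomorphism of V(M) by composition, and conversely a lift of the identity
is a section. -/
theorem lc_eq_zero_iff_subsingleton : lc k A M = 0 ↔ Subsingleton (SplittingCokernel k A M) := by
  rw [lc_eq_zero_iff_exists_section, Submodule.Quotient.subsingleton_iff,
    ← Atiyah.range_symbol]
  constructor
  · rintro ⟨s, hs⟩
    rw [LinearMap.range_eq_top]
    intro f
    refine ⟨s ∘ₗ f, ?_⟩
    ext1 D
    exact Subtype.ext (hs (f D))
  · intro h
    obtain ⟨s, hs⟩ := LinearMap.range_eq_top.1 h LinearMap.id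
    exact ⟨s, fun D => congrArg Subtype.val (LinearMap.congr_fun hs D)⟩

variable {k A M}

/-- On a free module all derivations lift to the Atiyah module, linearly. -/
theorem Atiyah.exists_section_of_free [Module.Free A M] :
    ∃ s : Derivation k A A →ₗ[A] Atiyah k A M, ∀ D, Atiyah.symbol k A M (s D) = D := by
  let b := Module.Free.chooseBasis A M
  let P : Derivation k A A → M →ₗ[k] M := fun D =>
    (b.repr.symm.toLinearMap.restrictScalars k) ∘ₗ
      (Finsupp.mapRange.linearMap D.toLinearMap) ∘ₗ (b.repr.toLinearMap.restrictScalars k)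
  have hP : ∀ D m i, b.repr (P D m) i = D (b.repr m i) := by
    intro D m i
    simp [P]
  refine ⟨{ toFun := fun D => ⟨(D, P D), fun a m => ?_⟩
            map_add' := fun D D' => ?_
            map_smul' := fun a D => ?_ }, fun D => rfl⟩
  · apply b.repr.injective
    ext i
    simp only [hP, map_smul, map_add, Finsupp.smul_apply, Finsupp.add_apply, smul_eq_mul,
      Derivation.leibniz, LinearMap.id_apply]
    ring
  · refine AtiyahAlong.ext (fun _ => rfl) fun m => b.repr.injective ?_
    ext i
    simp [hP]
  · refine AtiyahAlong.ext (fun _ => rfl) fun m => b.repr.injective ?_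
    ext i
    simp [hP]

theorem subsingleton_symbolCokernel_of_free [Module.Free A M] :
    Subsingleton (SymbolCokernel k A M) := by
  obtain ⟨s, hs⟩ := Atiyah.exists_section_of_free (k := k) (A := A) (M := M)
  rw [Submodule.Quotient.subsingleton_iff, LinearMap.range_eq_top]
  exact fun D => ⟨s D, hs D⟩

theorem subsingleton_splittingCokernel_of_free [Module.Free A M] :
    Subsingleton (SplittingCokernel k A M) := by
  obtain ⟨s, hs⟩ := Atiyah.exists_section_of_free (k := k) (A := A) (M := M)
  rw [← lc_eq_zero_iff_subsingleton, lc_eq_zero_iff_exists_section]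
  exact ⟨s ∘ₗ (V k A M).subtype, fun D => hs D⟩

end Criteria

/-! ### Finiteness and base change of the two cokernels -/

section Transfer

variable (k : Type v) (A M B N : Type u) [Field k] [CommRing A] [Algebra k A]
  [CommRing B] [Algebra k B] [Algebra A B] [IsScalarTower k A B]
  [AddCommGroup M] [Module A M] [Module k M] [IsScalarTower k A M]
  [AddCommGroup N] [Module B N] [Module k N] [IsScalarTower k B N]
  [Module A N] [IsScalarTower A B N] [IsScalarTower k A N]
  [Algebra.FiniteType k A] [Module.Flat A B] [Module.Finite A M]

theorem finite_derivation : Module.Finite A (Derivation k A A) := by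
  have := Algebra.FiniteType.isNoetherianRing k A
  exact Module.Finite.equiv (KaehlerDifferential.linearMapEquivDerivation k A)

theorem finite_symbolCokernel : Module.Finite A (SymbolCokernel k A M) := by
  have := finite_derivation k A
  infer_instance

theorem finite_splittingCokernel : Module.Finite A (SplittingCokernel k A M) := by
  have := finite_derivation k A
  have := Algebra.FiniteType.isNoetherianRing k A
  infer_instance

variable {k A M B N}

theorem exists_isBaseChange_symbolCokernel
    (hder : Function.Bijective (Derivation.compAlgebraMapL k A B B)) {ι : M →ₗ[A] N}
    (hι : IsBaseChange B ι) :
    ∃ h : SymbolCokernel k A M →ₗ[A] SymbolCokernel k B N, IsBaseChange B h := by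
  obtain ⟨τ, δ, hτ, hδ, comm⟩ := Atiyah.exists_isBaseChange hder hι
  obtain ⟨h, hh, -⟩ := isBaseChange_mapQ_range hτ hδ comm
  exact ⟨h, hh⟩

/-- V(M) is the range of the symbol, so it commutes with flat base change; being finitely presented,
so do the Hom modules out of it. The square of Hom modules need only be checked on the image of
V(M). -/
theorem exists_isBaseChange_splittingCokernel
    (hder : Function.Bijective (Derivation.compAlgebraMapL k A B B)) {ι : M →ₗ[A] N}
    (hι : IsBaseChange B ι) :
    ∃ h : SplittingCokernel k A M →ₗ[A] SplittingCokernel k B N, IsBaseChange B h := by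
  have := finite_derivation k A
  have := Algebra.FiniteType.isNoetherianRing k A
  have : Module.FinitePresentation A (LinearMap.range (Atiyah.symbol k A M)) :=
    Module.finitePresentation_of_finite _ _
  obtain ⟨τ, δ, hτ, hδ, comm⟩ := Atiyah.exists_isBaseChange hder hι
  obtain ⟨h₀, j, hh₀⟩ := isBaseChange_range hτ hδ comm
  obtain ⟨h, hh, -⟩ := isBaseChange_mapQ_range (g := Atiyah.compSymbol k A M)
    (g' := Atiyah.compSymbol k B N)
    (isBaseChange_linearMapLeftRightHom j hτ) (isBaseChange_linearMapLeftRightHom j j) (by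
      intro f
      apply j.algHom_ext
      intro D
      have h1 : h₀ ((Atiyah.symbol k A M).rangeRestrict (f D)) =
          (Atiyah.symbol k B N).rangeRestrict (τ (f D)) :=
        Subtype.ext ((hh₀ _).trans (comm _))
      refine (IsBaseChange.linearMapLeftRightHom_comp_apply j h₀ _ D).trans (h1.trans ?_)
      exact (congrArg (Atiyah.symbol k B N).rangeRestrict
        (IsBaseChange.linearMapLeftRightHom_comp_apply j τ f D)).symm)
  exact ⟨h, hh⟩

end Transfer

/-! ### Extension of derivations to localizations and completions -/

section Extension

variable (k : Type v) (A : Type u) [Field k] [CommRing A] [Algebra k A]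

/-- Formal étaleness gives Ω[B⁄k] ≅ B ⊗ Ω[A⁄k], and derivations into B are linear maps out of these
modules. -/
theorem bijective_compAlgebraMapL_of_formallyEtale (B : Type u) [CommRing B] [Algebra k B]
    [Algebra A B] [IsScalarTower k A B] [Algebra.FormallyEtale A B] :
    Function.Bijective (Derivation.compAlgebraMapL k A B B) := by
  have hbc := KaehlerDifferential.isBaseChange_of_formallyEtale k A B
  constructor
  · intro D D' h
    have h' : ∀ a, D (algebraMap A B a) = D' (algebraMap A B a) := fun a => Derivation.congr_fun h a
    rw [← D.liftKaehlerDifferential_comp, ← D'.liftKaehlerDifferential_comp]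
    refine congrArg (fun f : Ω[B⁄k] →ₗ[B] B => f.compDer (KaehlerDifferential.D k B)) ?_
    apply hbc.algHom_ext
    intro x
    have hx : x ∈ Submodule.span A (Set.range (KaehlerDifferential.D k A)) := by
      rw [KaehlerDifferential.span_range_derivation]
      trivial
    induction hx using Submodule.span_induction with
    | mem x hx =>
      obtain ⟨a, rfl⟩ := hx
      simp [h']
    | zero => simp
    | add x y _ _ hx hy => simp only [map_add, hx, hy]
    | smul a x _ hx =>
      rw [map_smul, ← algebraMap_smul B a, map_smul, map_smul, hx]
  · intro D
    refine ⟨(hbc.lift D.liftKaehlerDifferential).compDer (KaehlerDifferential.D k B), ?_⟩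
    ext a
    have := hbc.lift_eq D.liftKaehlerDifferential (KaehlerDifferential.D k A a)
    simpa using this

variable {k A} (I : Ideal A)

/-- A derivation maps `I ^ n` into `I ^ (n - 1)` times the target. -/
theorem derivation_apply_mem_pow_smul_top {N : Type*} [AddCommGroup N] [Module A N] [Module k N]
    (D : Derivation k A N) (n : ℕ) {a : A} (ha : a ∈ I ^ n) :
    D a ∈ (I ^ (n - 1) • ⊤ : Submodule A N) := by
  induction n generalizing a with
  | zero => simp
  | succ n ih =>
    rw [pow_succ] at ha
    induction ha using Submodule.mul_induction_on' with
    | mem_mul_mem x hx y hy =>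
      rw [Derivation.leibniz]
      refine add_mem (Submodule.smul_mem_smul hx trivial) ?_
      -- For exponent 0 the target is everything; otherwise the factor y in `I` restores the power
      -- lost by D.
      obtain _ | n := n
      · simp
      · have := Submodule.smul_mem_smul hy (ih hx)
        rwa [← smul_assoc, smul_eq_mul, Nat.add_sub_cancel, ← pow_succ'] at this
    | add x _ y _ hx hy => rw [map_add]; exact add_mem hx hy

variable (k)

/-- A derivation killing A is `A`-linear, so it preserves Iⁿ times the completion. Every element
lies in A modulo this submodule, which is the kernel of evaluation at level n because `I` is
finitely generated. -/
theorem injective_compAlgebraMapL_adicCompletion (hI : I.FG) :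
    Function.Injective (Derivation.compAlgebraMapL k A (AdicCompletion I A)
      (AdicCompletion I A)) := by
  rw [injective_iff_map_eq_zero]
  intro D hD
  have hD' : ∀ a, D (algebraMap A (AdicCompletion I A) a) = 0 := fun a => Derivation.congr_fun hD a
  let L : AdicCompletion I A →ₗ[A] AdicCompletion I A :=
    { toFun := D
      map_add' := map_add D
      map_smul' := fun a x => by
        rw [Algebra.smul_def, Derivation.leibniz, hD', smul_zero, add_zero, RingHom.id_apply,
          algebraMap_smul] }
  ext1 x
  refine AdicCompletion.ext fun n => ?_
  obtain ⟨a, ha⟩ := Submodule.mkQ_surjective _ (x.val n)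
  have hx : x - algebraMap A (AdicCompletion I A) a ∈
      (I ^ n • ⊤ : Submodule A (AdicCompletion I A)) := by
    rw [AdicCompletion.pow_smul_top_eq_ker_eval hI, LinearMap.mem_ker, map_sub, sub_eq_zero]
    exact ha.symm
  have hLx : L (x - algebraMap A (AdicCompletion I A) a) ∈
      (I ^ n • ⊤ : Submodule A (AdicCompletion I A)) := by
    have := Submodule.mem_map_of_mem (f := L) hx
    rw [Submodule.map_smul''] at this
    exact Submodule.smul_mono le_rfl le_top this
  rw [map_sub, AdicCompletion.pow_smul_top_eq_ker_eval hI, LinearMap.mem_ker] at hLx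
  have h0 : L (algebraMap A (AdicCompletion I A) a) = 0 := hD' a
  rw [h0, sub_zero] at hLx
  exact hLx

variable {k}

theorem eval_derivation_eq (D : Derivation k A (AdicCompletion I A)) {n : ℕ} {a b : A}
    (h : Submodule.Quotient.mk (p := (I ^ (n + 1) • ⊤ : Ideal A)) a = Submodule.Quotient.mk b) :
    AdicCompletion.eval I A n (D a) = AdicCompletion.eval I A n (D b) := by
  rw [Submodule.Quotient.eq, smul_eq_mul, Ideal.mul_top] at h
  have hD : D (a - b) ∈ (I ^ n • ⊤ : Submodule A (AdicCompletion I A)) :=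
    derivation_apply_mem_pow_smul_top I D (n + 1) h
  have hker : (AdicCompletion.eval I A n) (D (a - b)) = 0 :=
    LinearMap.mem_ker.1 (AdicCompletion.pow_smul_top_le_ker_eval I n hD)
  rwa [map_sub, map_sub, sub_eq_zero] at hker

/-- The extension of a derivation to the completion. -/
def completionDerivFun (D : Derivation k A (AdicCompletion I A)) (x : AdicCompletion I A) :
    AdicCompletion I A :=
  -- A representative modulo Iⁿ⁺¹ is needed at level n, since D loses one power of `I`.
  ⟨fun n => AdicCompletion.eval I A n (D (Quotient.out (x.val (n + 1)))), by
    intro m n hmn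
    refine (AdicCompletion.transitionMap_comp_eval_apply I A hmn _).trans ?_
    apply eval_derivation_eq
    have h1 : Submodule.Quotient.mk (Quotient.out (x.val (n + 1))) = x.val (n + 1) :=
      Quotient.out_eq _
    have h2 : Submodule.Quotient.mk (Quotient.out (x.val (m + 1))) = x.val (m + 1) :=
      Quotient.out_eq _
    exact (congrArg (AdicCompletion.transitionMap I A (Nat.succ_le_succ hmn)) h1).trans
      ((x.property (Nat.succ_le_succ hmn)).trans h2.symm)⟩

theorem completionDerivFun_val (D : Derivation k A (AdicCompletion I A)) (x : AdicCompletion I A)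
    {n : ℕ} {a : A} (h : Submodule.Quotient.mk a = x.val (n + 1)) :
    (completionDerivFun I D x).val n = (D a).val n := by
  apply eval_derivation_eq
  rw [h]
  exact Quotient.out_eq _

theorem AdicCompletion.mk_eq_val {x : AdicCompletion I A} {n : ℕ} {a : A}
    (h : Submodule.Quotient.mk a = x.val (n + 1)) : Submodule.Quotient.mk a = x.val n := by
  rw [← x.property n.le_succ, ← h]
  rfl

/-- The extension of a derivation to the completion. -/
def completionDeriv (D : Derivation k A (AdicCompletion I A)) :
    Derivation k (AdicCompletion I A) (AdicCompletion I A) :=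
  Derivation.mk'
    { toFun := completionDerivFun I D
      map_add' := by
        intro x y
        refine AdicCompletion.ext fun n => ?_
        obtain ⟨a, ha⟩ := Submodule.mkQ_surjective _ (x.val (n + 1))
        obtain ⟨b, hb⟩ := Submodule.mkQ_surjective _ (y.val (n + 1))
        rw [AdicCompletion.val_add_apply, completionDerivFun_val I D x ha,
          completionDerivFun_val I D y hb, completionDerivFun_val I D (x + y) (a := a + b),
          map_add, AdicCompletion.val_add_apply]
        rw [AdicCompletion.val_add_apply, ← ha, ← hb]
        rfl
      map_smul' := by
        intro c x
        refine AdicCompletion.ext fun n => ?_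
        obtain ⟨a, ha⟩ := Submodule.mkQ_surjective _ (x.val (n + 1))
        rw [RingHom.id_apply, AdicCompletion.val_smul_apply, completionDerivFun_val I D x ha,
          completionDerivFun_val I D (c • x) (a := c • a), Derivation.map_smul,
          AdicCompletion.val_smul_apply]
        rw [AdicCompletion.val_smul_apply, ← ha]
        rfl }
    (by
      intro x y
      refine AdicCompletion.ext fun n => ?_
      obtain ⟨a, ha⟩ := Submodule.mkQ_surjective _ (x.val (n + 1))
      obtain ⟨b, hb⟩ := Submodule.mkQ_surjective _ (y.val (n + 1))
      simp only [LinearMap.coe_mk, AddHom.coe_mk, smul_eq_mul]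
      -- The representatives modulo Iⁿ⁺¹ also represent the undifferentiated factors modulo Iⁿ.
      rw [AdicCompletion.val_add_apply, AdicCompletion.val_mul, AdicCompletion.val_mul,
        completionDerivFun_val I D x ha, completionDerivFun_val I D y hb,
        completionDerivFun_val I D (x * y) (a := a * b), Derivation.leibniz,
        AdicCompletion.val_add_apply, ← AdicCompletion.mk_eq_val I ha,
        ← AdicCompletion.mk_eq_val I hb]
      · rfl
      · rw [AdicCompletion.val_mul, ← ha, ← hb]
        rfl)

variable (k)

theorem bijective_compAlgebraMapL_adicCompletion (hI : I.FG) :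
    Function.Bijective (Derivation.compAlgebraMapL k A (AdicCompletion I A)
      (AdicCompletion I A)) := by
  refine ⟨injective_compAlgebraMapL_adicCompletion k I hI, fun D => ⟨completionDeriv I D, ?_⟩⟩
  ext1 a
  refine AdicCompletion.ext fun n => ?_
  exact completionDerivFun_val I D _ rfl

/-- Evaluation to the nonzero ring A/I kills the extended ideal. -/
theorem map_adicCompletion_ne_top (hI : I ≠ ⊤) :
    I.map (algebraMap A (AdicCompletion I A)) ≠ ⊤ := by
  intro h
  have := Ideal.Quotient.nontrivial_iff.2 hI
  have hle : I.map (algebraMap A (AdicCompletion I A)) ≤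
      RingHom.ker (AdicCompletion.evalOneₐ I).toRingHom := by
    rw [Ideal.map_le_iff_le_comap]
    intro a ha
    exact Ideal.Quotient.eq_zero_iff_mem.2 ha
  rw [h] at hle
  have h1 : (AdicCompletion.evalOneₐ I) 1 = 0 := hle trivial
  rw [map_one] at h1
  exact one_ne_zero h1

theorem isBaseChange_adicCompletion_of [IsNoetherianRing A] (M : Type u) [AddCommGroup M]
    [Module A M] [Module.Finite A M] :
    IsBaseChange (AdicCompletion I A) (AdicCompletion.of I M) :=
  IsBaseChange.of_equiv (AdicCompletion.ofTensorProductEquivOfFiniteNoetherian I M) fun x => by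
    simp

end Extension

/-! ### The local criterion -/

section Main

variable (k : Type v) (A M : Type u) [Field k] [CommRing A] [Algebra k A]
  [AddCommGroup M] [Module A M] [Module k M] [IsScalarTower k A M]

theorem bijective_compAlgebraMapL_localization (p : Ideal A) [p.IsPrime] :
    Function.Bijective (Derivation.compAlgebraMapL k A (Localization.AtPrime p)
      (Localization.AtPrime p)) :=
  have := Algebra.FormallyEtale.of_isLocalization (Rₘ := Localization.AtPrime p) p.primeCompl
  bijective_compAlgebraMapL_of_formallyEtale k A _

theorem isBaseChange_mkLinearMap (p : Ideal A) [p.IsPrime] :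
    IsBaseChange (Localization.AtPrime p) (LocalizedModule.mkLinearMap p.primeCompl M) :=
  IsLocalizedModule.isBaseChange p.primeCompl _ _

theorem map_localization_ne_top (p : Ideal A) [p.IsPrime] :
    p.map (algebraMap A (Localization.AtPrime p)) ≠ ⊤ := by
  rw [Localization.AtPrime.map_eq_maximalIdeal]
  exact Ideal.IsPrime.ne_top'

variable {k A M} {m : Ideal A} [Algebra.FiniteType k A] [Module.Finite A M]

/-- If I ≠ `m`, then M is free at I and the cokernel vanishes after localizing there, which a
surjection onto A/I forbids. -/
theorem eq_of_surjective_symbolCokernel (hM : LocallyFreeAwayFrom m M) {I : Ideal A}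
    [I.IsMaximal]
    (φ : SymbolCokernel k A M →ₗ[A] A ⧸ I) (hφ : Function.Surjective φ) : I = m := by
  by_contra hI
  have := hM ⟨I, inferInstance⟩ hI
  obtain ⟨h, hh⟩ := exists_isBaseChange_symbolCokernel
    (bijective_compAlgebraMapL_localization k A I) (isBaseChange_mkLinearMap A M I)
  have : Subsingleton (SymbolCokernel k (Localization.AtPrime I)
    (LocalizedModule I.primeCompl M)) := subsingleton_symbolCokernel_of_free
  exact map_localization_ne_top A I (map_eq_top_of_subsingleton hh I φ hφ)

theorem eq_of_surjective_splittingCokernel (hM : LocallyFreeAwayFrom m M) {I : Ideal A}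
    [I.IsMaximal]
    (φ : SplittingCokernel k A M →ₗ[A] A ⧸ I) (hφ : Function.Surjective φ) : I = m := by
  by_contra hI
  have := hM ⟨I, inferInstance⟩ hI
  obtain ⟨h, hh⟩ := exists_isBaseChange_splittingCokernel
    (bijective_compAlgebraMapL_localization k A I) (isBaseChange_mkLinearMap A M I)
  have : Subsingleton (SplittingCokernel k (Localization.AtPrime I)
    (LocalizedModule I.primeCompl M)) := subsingleton_splittingCokernel_of_free
  exact map_localization_ne_top A I (map_eq_top_of_subsingleton hh I φ hφ)

/-- A finite module that is supported at most at `m` vanishes if and only if its base change to `B`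
vanishes, provided that `m` does not generate the unit ideal of `B`. -/
theorem subsingleton_iff_of_isBaseChange {B X Y : Type*} [CommRing B] [Algebra A B]
    [AddCommGroup X] [Module A X] [Module.Finite A X] [AddCommGroup Y] [Module A Y] [Module B Y]
    [IsScalarTower A B Y] {h : X →ₗ[A] Y} (hh : IsBaseChange B h)
    (hm : m.map (algebraMap A B) ≠ ⊤)
    (hX : ∀ (I : Ideal A) [I.IsMaximal] (φ : X →ₗ[A] A ⧸ I), Function.Surjective φ → I = m) :
    Subsingleton X ↔ Subsingleton Y := by
  constructor
  · intro _
    exact hh.equiv.symm.toEquiv.subsingleton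
  · intro _
    by_contra hX'
    rw [not_subsingleton_iff_nontrivial] at hX'
    obtain ⟨I, hI, φ, hφ⟩ := exists_surjective_quot_maximal (R := A) (M := X)
    obtain rfl := hX I φ hφ
    exact hm (map_eq_top_of_subsingleton hh I φ hφ)

/-- The conditions `V(M) = Der_k(A)` and `lc(M) = 0` may be checked after a flat base change along
which derivations extend uniquely. -/
theorem conditions_iff (hM : LocallyFreeAwayFrom m M) {B N : Type u} [CommRing B] [Algebra k B]
    [Algebra A B] [IsScalarTower k A B] [AddCommGroup N] [Module B N] [Module k N] [IsScalarTower k B N]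
    [Module A N] [IsScalarTower A B N] [IsScalarTower k A N] [Module.Flat A B]
    (hder : Function.Bijective (Derivation.compAlgebraMapL k A B B)) {ι : M →ₗ[A] N}
    (hι : IsBaseChange B ι) (hm : m.map (algebraMap A B) ≠ ⊤) :
    (V k A M = ⊤ ↔ V k B N = ⊤) ∧ (lc k A M = 0 ↔ lc k B N = 0) := by
  have := finite_symbolCokernel k A M
  have := finite_splittingCokernel k A M
  obtain ⟨h, hh⟩ := exists_isBaseChange_symbolCokernel hder hι
  obtain ⟨h', hh'⟩ := exists_isBaseChange_splittingCokernel hder hι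
  rw [V_eq_top_iff_subsingleton, V_eq_top_iff_subsingleton, lc_eq_zero_iff_subsingleton,
    lc_eq_zero_iff_subsingleton]
  exact ⟨subsingleton_iff_of_isBaseChange hh hm fun I _ φ hφ =>
      eq_of_surjective_symbolCokernel hM φ hφ,
    subsingleton_iff_of_isBaseChange hh' hm fun I _ φ hφ =>
      eq_of_surjective_splittingCokernel hM φ hφ⟩

end Main

end
end KodairaSpencer

theorem mainTheorem7
    (k : Type v) [Field k] [IsAlgClosed k] [CharZero k]
    (A : Type u) [CommRing A] [Algebra k A] [Algebra.FiniteType k A]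
    (m : Ideal A) [m.IsMaximal]
    (M : Type u) [AddCommGroup M] [Module A M] [Module k M] [IsScalarTower k A M]
    [Module.Finite A M]
    (hM : KodairaSpencer.LocallyFreeAwayFrom m M) :
    ((KodairaSpencer.V k A M = ⊤ ↔
        KodairaSpencer.V k (Localization.AtPrime m) (LocalizedModule m.primeCompl M) = ⊤) ∧
      (KodairaSpencer.V k (Localization.AtPrime m) (LocalizedModule m.primeCompl M) = ⊤ ↔
        KodairaSpencer.V k (AdicCompletion m A) (AdicCompletion m M) = ⊤)) ∧
    ((KodairaSpencer.lc k A M = 0 ↔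
        KodairaSpencer.lc k (Localization.AtPrime m) (LocalizedModule m.primeCompl M) = 0) ∧
      (KodairaSpencer.lc k (Localization.AtPrime m) (LocalizedModule m.primeCompl M) = 0 ↔
        KodairaSpencer.lc k (AdicCompletion m A) (AdicCompletion m M) = 0)) := by
  have := Algebra.FiniteType.isNoetherianRing k A
  -- Localization and completion are each compared with A; the equivalence between them follows by
  -- composition.
  have h₁ := KodairaSpencer.conditions_iff hM
    (KodairaSpencer.bijective_compAlgebraMapL_localization k A m)
    (KodairaSpencer.isBaseChange_mkLinearMap A M m) (KodairaSpencer.map_localization_ne_top A m)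
  have h₂ := KodairaSpencer.conditions_iff hM
    (KodairaSpencer.bijective_compAlgebraMapL_adicCompletion k m m.fg_of_isNoetherianRing)
    (KodairaSpencer.isBaseChange_adicCompletion_of m M)
    (KodairaSpencer.map_adicCompletion_ne_top m Ideal.IsPrime.ne_top')
  exact ⟨⟨h₁.1, h₁.1.symm.trans h₂.1⟩, ⟨h₁.2, h₁.2.symm.trans h₂.2⟩⟩
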